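/- Fix a clause length $k\ge 2$ and an exponent $\beta>2$. Random $k$-SAT. Given positive weights $w_1,\dots,w_n$ with $n\ge k$, put $p_i=w_i/\sum_j w_j$. A random $k$-SAT formula $\Phi$ on variables $x_1,\dots,x_n$ consists of $m$ independent random clauses. Each clause is obtained by drawing $k$ variables independently from $(p_i)$, repeating until no variables coincide, and then negating each of the $k$ variables independently with probability $1/2$. For real $d$ let $N_{\ge d}$ be the number of variables that appear (negated or not) at least $d$ times in $\Phi$. Notation. For a constant $K\ge 1$ write $x=\Theta_K(y)$ if $y/K\le x\le Ky$. Let $w_{\min}=\min_i w_i$, $w_{\max}=\max_i w_i$ and $F(v)=\tfrac1n\,|\{i: w_i\ge v\}|$. The weights follow a power law with exponent $\beta$ and constant $K$ if $$w_{\min}=\Theta_K(1),\qquad w_{\max}=\Theta_K\bigl(n^{1/(\beta-1)}\bigr),\qquad F(v)=\Theta_K\bigl(v^{1-\beta}\bigr)\ \text{ for all } v\in[w_{\min},w_{\max}].$$ Theorem. For every $k\ge2$, $\beta>2$ and $K\ge1$ there are constants $L\ge1$ and $\delta>0$ such that the following holds for all $n\ge k$, all weights $w_1,\dots,w_n$ that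 follow a power law with exponent $\beta$ and constant $K$, and all $m=\Theta_K(n)$. There are $d_{\min}=\Theta_L(w_{\min})$ and $d_{\max}=\Theta_L(w_{\max})$ such that, with probability at least $1-L\,n^{-\delta}$, $$N_{\ge d}=\Theta_L\bigl(n\,d^{1-\beta}\bigr)\quad\text{simultaneously for all real } d\in[d_{\min},d_{\max}].$$ -/

import Mathlib

open MeasureTheory ProbabilityTheory

namespace PowerLawSAT

noncomputable section

/-- `x = Θ(y)` with the explicit hidden constant `K`: `y / K ≤ x ≤ K * y`. -/
def ThetaWith (K x y : ℝ) : Prop := K⁻¹ * y ≤ x ∧ x ≤ K * y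

/-- The smallest weight. -/
def wMin {n : ℕ} (w : Fin n → ℝ) : ℝ := ⨅ i, w i

/-- The largest weight. -/
def wMax {n : ℕ} (w : Fin n → ℝ) : ℝ := ⨆ i, w i

/-- `F(v)`: the probability that a weight selected uniformly at random is at least `v`. -/
def tail {n : ℕ} (w : Fin n → ℝ) (v : ℝ) : ℝ :=
  (Finset.card {i : Fin n | v ≤ w i} : ℝ) / (n : ℝ)

/-- General power law with exponent `β`, all hidden constants being bounded by `K`:
`w_min = Θ(1)`, `w_max = Θ(n ^ (1 / (β - 1)))`, and `F(v) = Θ(v ^ (1 - β))` for all `v` between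
`w_min` and `w_max`. The weights need not be sorted. -/
structure IsPowerLaw (K β : ℝ) {n : ℕ} (w : Fin n → ℝ) : Prop where
  min_theta : ThetaWith K (wMin w) 1
  max_theta : ThetaWith K (wMax w) ((n : ℝ) ^ (1 / (β - 1)))
  tail_theta : ∀ v ∈ Set.Icc (wMin w) (wMax w), ThetaWith K (tail w v) (v ^ (1 - β))

/-- The distribution on the variables: variable `i` has probability `w i / ∑ j, w j`. -/
def varLaw {n : ℕ} (w : Fin n → ℝ) : Measure (Fin n) :=
  ∑ i, ENNReal.ofReal (w i / ∑ j, w j) • Measure.dirac i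

/-- A clause with `k` literals over `n` variables: `c.1 j` is the variable of the `j`-th literal
and `c.2 j` tells whether this literal is negated. -/
abbrev Clause (n k : ℕ) : Type := (Fin k → Fin n) × (Fin k → Bool)

/-- A formula with `m` clauses. -/
abbrev Formula (n k m : ℕ) : Type := Fin m → Clause n k

/-- The law of a random clause: `k` variables are drawn independently, conditioned on being
pairwise distinct (the outcome of repeating the draw until no variables coincide); then each is
negated independently with probability `1 / 2`. -/
def clauseLaw {n : ℕ} (k : ℕ) (w : Fin n → ℝ) : Measure (Clause n k) :=
  (cond (Measure.pi fun _ : Fin k => varLaw w) {v | Function.Injective v}).prod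
    (Measure.pi fun _ : Fin k => (PMF.uniformOfFintype Bool).toMeasure)

/-- The law of a random `k`-SAT formula: `m` independent random clauses. -/
def formulaLaw {n : ℕ} (k m : ℕ) (w : Fin n → ℝ) : Measure (Formula n k m) :=
  Measure.pi fun _ : Fin m => clauseLaw k w

/-- The number of occurrences (negated or not) of the variable `x` in the formula `Φ`. -/
def occurrences {n k m : ℕ} (Φ : Formula n k m) (x : Fin n) : ℕ :=
  Finset.card {a : Fin m × Fin k | (Φ a.1).1 a.2 = x}

/-- `N_{≥ d}`: the number of variables that appear at least `d` times in `Φ`. -/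
def numAtLeast {n k m : ℕ} (Φ : Formula n k m) (d : ℝ) : ℕ :=
  Finset.card {x : Fin n | d ≤ (occurrences Φ x : ℝ)}

end

end PowerLawSAT

namespace PowerLawSAT

/-! A variable of weight `w` occurs in one clause with probability of order `w / n`, hence about `w`
times in the formula. Indeed the largest drawing probability is O(n ^ (1 / (β - 1) - 1)), which
tends to 0 because β > 2, so conditioning on distinct variables distorts probabilities only by
constant factors, and the total weight is of order `n`.

Fix an integer threshold `d`. By Chernoff bounds, a variable of weight at least `C * d` has fewer
than `d` occurrences with probability at most exp(-d), and one of weight below `c * d` reaches `d`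
with probability at most exp(-d). The power law puts the numbers of variables with weight at least
`C * d` and `c * d` at order y = n d ^ (1 - β), and this should be the size of N_{≥ d}.

Two estimates bound the failure probability P. A union bound over variables gives 2 n exp(-d),
useless for small `d`. Replacing a clause changes N_{≥ d} by at most `k`, so its variance is O(n),
and Chebyshev at scale y gives O(d ^ (2β - 2) / n), useless near the top of the range. Writing P ^ 4
= P ^ 3 * P, with Chebyshev for the cube and the union bound for the last factor, gives P = O(n ^
(-1/2) exp(-d/8)) at every `d` in range. This is summable over `d`, so all integer thresholds hold
at once; real ones follow by rounding up. -/

theorem integral_pow_sum_pi {Ω : Type*} [MeasurableSpace Ω] (ν : Measure Ω) [IsProbabilityMeasure ν] (Z : Ω → ℕ)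
    (t : ℝ) (m : ℕ) :
    ∫ ω, t ^ (∑ i, Z (ω i)) ∂(Measure.pi fun _ : Fin m => ν) = (∫ x, t ^ Z x ∂ν) ^ m := by
  simp_rw [← Finset.prod_pow_eq_pow_sum]
  rw [integral_fintype_prod_eq_prod (fun (_ : Fin m) (x : Ω) => t ^ Z x)]
  simp

/-! ### Variance and Chernoff bounds on finite product spaces. -/

section ProductSpaces

variable {Ω : Type*} [MeasurableSpace Ω] [Finite Ω] [MeasurableSingletonClass Ω]

/-- A function on a finite probability space all of whose values are within `c` of each other has
variance at most `c ^ 2`. -/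
theorem variance_le_sq_of_forall_sub_le (ν : Measure Ω) [IsProbabilityMeasure ν] {c : ℝ}
    (g : Ω → ℝ) (hg : ∀ a b, |g a - g b| ≤ c) : Var[g; ν] ≤ c ^ 2 := by
  have hne : Nonempty Ω := nonempty_of_isProbabilityMeasure ν
  obtain ⟨a₀⟩ := hne
  have hc : 0 ≤ c := (abs_nonneg _).trans (hg a₀ a₀)
  have h := variance_le_sq_of_bounded (μ := ν) (X := g) (a := g a₀ - c) (b := g a₀ + c)
    (Filter.Eventually.of_forall fun a => by
      have := abs_le.1 (hg a a₀); constructor <;> linarith [this.1, this.2])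
    (measurable_of_finite g).aemeasurable
  calc _ ≤ _ := h
    _ = c ^ 2 := by ring

/-- Bounded differences: if changing one coordinate changes `f` by at most `c`, then the variance
of `f` under a product measure with `m` factors is at most `m * c ^ 2`. -/
theorem variance_pi_le_of_bounded_differences (ν : Measure Ω) [IsProbabilityMeasure ν] {c : ℝ}
    (m : ℕ) (f : (Fin m → Ω) → ℝ)
    (hf : ∀ ω i v, |f (Function.update ω i v) - f ω| ≤ c) :
    Var[f; Measure.pi fun _ : Fin m => ν] ≤ m * c ^ 2 := by
  induction m with
  | zero =>
    simpa using variance_le_sq_of_forall_sub_le (Measure.pi fun _ : Fin 0 => ν) (c := 0) f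
      fun a b => by rw [Subsingleton.elim a b]; simp
  | succ m ih =>
    set P := Measure.pi fun _ : Fin m => ν with hP
    -- Average out the first coordinate and apply the law of total variance: `g` inherits the
    -- bounded differences, which feeds the induction, and the conditional variance adds at most `c
    -- ^ 2`.
    let g : (Fin m → Ω) → ℝ := fun ω => ∫ x, f (Fin.cons x ω) ∂ν
    have key : ∀ h : (Fin (m + 1) → Ω) → ℝ,
        ∫ ω, h ω ∂(Measure.pi fun _ : Fin (m + 1) => ν) =
          ∫ ω, ∫ x, h (Fin.cons x ω) ∂ν ∂P := by
      intro h
      have hmp := (measurePreserving_piFinSuccAbove (fun _ : Fin (m + 1) => ν) 0).symm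
      rw [← hmp.integral_comp (MeasurableEquiv.measurableEmbedding _)]
      rw [integral_prod_symm]
      · simp [MeasurableEquiv.piFinSuccAbove, Fin.insertNthEquiv, hP]
      · exact Integrable.of_finite
    have hgd : ∀ ω i v, |g (Function.update ω i v) - g ω| ≤ c := by
      intro ω i v
      simp only [g]
      rw [← integral_sub Integrable.of_finite Integrable.of_finite]
      have := norm_integral_le_of_norm_le_const (μ := ν) (C := c)
        (f := fun x => f (Fin.cons x (Function.update ω i v)) - f (Fin.cons x ω))
        (Filter.Eventually.of_forall fun x => by
          have := hf (Fin.cons x ω) i.succ v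
          rwa [← Fin.cons_update] at this)
      simpa using this
    have h1 : ∀ ω, ∫ x, f (Fin.cons x ω) ^ 2 ∂ν ≤ g ω ^ 2 + c ^ 2 := by
      intro ω
      have hv := variance_le_sq_of_forall_sub_le ν (fun x => f (Fin.cons x ω)) (c := c) (by
        intro a b
        have := hf (Fin.cons b ω) 0 a
        rwa [Fin.update_cons_zero] at this)
      rw [variance_eq_sub (MemLp.of_discrete)] at hv
      simp only [Pi.pow_apply] at hv
      linarith
    have hv := ih g hgd
    rw [variance_eq_sub MemLp.of_discrete] at hv ⊢
    simp only [Pi.pow_apply] at hv ⊢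
    rw [key, key]
    have h2 : ∫ ω, ∫ x, f (Fin.cons x ω) ^ 2 ∂ν ∂P ≤ ∫ ω, (g ω ^ 2 + c ^ 2) ∂P :=
      integral_mono Integrable.of_finite Integrable.of_finite h1
    rw [integral_add Integrable.of_finite Integrable.of_finite] at h2
    simp only [integral_const, probReal_univ, smul_eq_mul, one_mul] at h2
    push_cast
    change _ - (∫ ω, g ω ∂P) ^ 2 ≤ _
    linarith

/-- Chebyshev's inequality on a finite probability space. -/
theorem measureReal_abs_sub_integral_ge_le (μ : Measure Ω) [IsProbabilityMeasure μ] (X : Ω → ℝ)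
    {V t : ℝ} (hV : Var[X; μ] ≤ V) (ht : 0 < t) :
    μ.real {ω | t ≤ |X ω - ∫ a, X a ∂μ|} ≤ V / t ^ 2 := by
  have h := meas_ge_le_variance_div_sq (μ := μ) (X := X) MemLp.of_discrete ht
  calc _ ≤ Var[X; μ] / t ^ 2 := ENNReal.toReal_le_of_le_ofReal
        (div_nonneg (variance_nonneg _ _) (sq_nonneg _)) h
    _ ≤ _ := by gcongr

/-- A sum of `m` independent copies of `Z` rarely stays below `d` if `m * P(Z ≠ 0)` is at least
`4 * d`. -/
theorem measureReal_sum_lt_le (ν : Measure Ω) [IsProbabilityMeasure ν] (Z : Ω → ℕ) (m d : ℕ)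
    (h : 4 * (d : ℝ) ≤ m * ν.real {x | Z x ≠ 0}) :
    (Measure.pi fun _ : Fin m => ν).real {ω | ∑ i, Z (ω i) < d} ≤ Real.exp (-d) := by
  classical
  set q := ν.real {x | Z x ≠ 0} with hq
  -- Chernoff with base 1/2: the `m`-fold product of this bound is at most exp(-2d), and Markov's
  -- inequality costs only 2 ^ d ≤ exp(d).
  have h1 : ∫ x, (1 / 2 : ℝ) ^ Z x ∂ν ≤ Real.exp (-(q / 2)) := by
    have : ∫ x, (1 / 2 : ℝ) ^ Z x ∂ν ≤
        ∫ x, (1 - (1 / 2) * Set.indicator {x | Z x ≠ 0} 1 x : ℝ) ∂ν := by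
      refine integral_mono Integrable.of_finite Integrable.of_finite fun x => ?_
      by_cases hx : Z x = 0
      · simp [hx]
      · simp only [Set.indicator, Set.mem_ofPred_eq, ne_eq, hx, not_false_eq_true, if_true,
          Pi.one_apply]
        calc (1 / 2 : ℝ) ^ Z x ≤ (1 / 2) ^ 1 :=
              pow_le_pow_of_le_one (by norm_num) (by norm_num) (by omega)
          _ = _ := by norm_num
    rw [integral_sub Integrable.of_finite Integrable.of_finite, integral_const_mul,
      integral_indicator_one (Set.toFinite _).measurableSet] at this
    simp only [integral_const, probReal_univ, smul_eq_mul, one_mul] at this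
    have := Real.add_one_le_exp (-(q / 2))
    linarith
  have h2 : (1 / 2 : ℝ) ^ d * (Measure.pi fun _ : Fin m => ν).real {ω | ∑ i, Z (ω i) < d} ≤
      ∫ ω, (1 / 2 : ℝ) ^ (∑ i, Z (ω i)) ∂(Measure.pi fun _ : Fin m => ν) := by
    refine le_trans ?_ (mul_meas_ge_le_integral_of_nonneg (Filter.Eventually.of_forall
      fun ω => by positivity) Integrable.of_finite ((1 / 2 : ℝ) ^ d))
    refine mul_le_mul_of_nonneg_left (measureReal_mono fun ω hω => ?_) (by positivity)
    exact pow_le_pow_of_le_one (by norm_num : (0 : ℝ) ≤ 1 / 2) (by norm_num)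
      (le_of_lt (show ∑ i, Z (ω i) < d from hω))
  rw [integral_pow_sum_pi] at h2
  have h3 : (∫ x, (1 / 2 : ℝ) ^ Z x ∂ν) ^ m ≤ Real.exp (-(2 * d)) := by
    calc _ ≤ Real.exp (-(q / 2)) ^ m :=
          pow_le_pow_left₀ (integral_nonneg fun x => by positivity) h1 m
      _ = Real.exp (-(m * q / 2)) := by rw [← Real.exp_nat_mul]; ring_nf
      _ ≤ _ := Real.exp_le_exp.2 (by linarith)
  have h4 : (2 : ℝ) ^ d ≤ Real.exp d := by
    calc (2 : ℝ) ^ d ≤ Real.exp 1 ^ d :=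
          pow_le_pow_left₀ (by norm_num) (by linarith [Real.add_one_le_exp (1 : ℝ)]) d
      _ = _ := by rw [← Real.exp_nat_mul]; simp
  calc (Measure.pi fun _ : Fin m => ν).real {ω | ∑ i, Z (ω i) < d}
      = 2 ^ d * ((1 / 2 : ℝ) ^ d *
          (Measure.pi fun _ : Fin m => ν).real {ω | ∑ i, Z (ω i) < d}) := by
        rw [← mul_assoc, ← mul_pow]; norm_num
    _ ≤ Real.exp d * Real.exp (-(2 * d)) := by
        gcongr
        exact h2.trans h3
    _ = _ := by rw [← Real.exp_add]; ring_nf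

/-- A sum of `m` independent copies of `Z ≤ k` rarely reaches `d` if `m * P(Z ≠ 0)` is at most
`d * exp (-2 * k)`. -/
theorem measureReal_le_sum_le (ν : Measure Ω) [IsProbabilityMeasure ν] (Z : Ω → ℕ) (m d k : ℕ)
    (hZ : ∀ x, Z x ≤ k) (h : m * ν.real {x | Z x ≠ 0} * Real.exp (2 * k) ≤ d) :
    (Measure.pi fun _ : Fin m => ν).real {ω | d ≤ ∑ i, Z (ω i)} ≤ Real.exp (-d) := by
  classical
  set q := ν.real {x | Z x ≠ 0} with hq
  have he : (1 : ℝ) ≤ Real.exp 2 := Real.one_le_exp (by norm_num)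
  -- Chernoff with base exp(2): Markov's inequality gains exp(-2d), while the hypothesis keeps the
  -- generating function of the sum below exp(d).
  have h1 : ∫ x, (Real.exp 2) ^ Z x ∂ν ≤ Real.exp (q * Real.exp (2 * k)) := by
    have : ∫ x, (Real.exp 2) ^ Z x ∂ν ≤
        ∫ x, (1 + Real.exp (2 * k) * Set.indicator {x | Z x ≠ 0} 1 x : ℝ) ∂ν := by
      refine integral_mono Integrable.of_finite Integrable.of_finite fun x => ?_
      by_cases hx : Z x = 0
      · simp [hx]
      · simp only [Set.indicator, Set.mem_ofPred_eq, ne_eq, hx, not_false_eq_true, if_true,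
          Pi.one_apply]
        calc (Real.exp 2) ^ Z x ≤ (Real.exp 2) ^ k := pow_le_pow_right₀ he (hZ x)
          _ = Real.exp (2 * k) := by rw [← Real.exp_nat_mul, mul_comm]
          _ ≤ _ := by linarith
    rw [integral_add Integrable.of_finite Integrable.of_finite, integral_const_mul,
      integral_indicator_one (Set.toFinite _).measurableSet] at this
    simp only [integral_const, probReal_univ, smul_eq_mul, one_mul] at this
    have := Real.add_one_le_exp (q * Real.exp (2 * k))
    linarith
  have h2 : (Real.exp 2) ^ d * (Measure.pi fun _ : Fin m => ν).real {ω | d ≤ ∑ i, Z (ω i)} ≤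
      ∫ ω, (Real.exp 2) ^ (∑ i, Z (ω i)) ∂(Measure.pi fun _ : Fin m => ν) := by
    refine le_trans ?_ (mul_meas_ge_le_integral_of_nonneg (Filter.Eventually.of_forall
      fun ω => by positivity) Integrable.of_finite ((Real.exp 2) ^ d))
    refine mul_le_mul_of_nonneg_left (measureReal_mono fun ω hω => ?_) (by positivity)
    exact pow_le_pow_right₀ he (show d ≤ ∑ i, Z (ω i) from hω)
  rw [integral_pow_sum_pi] at h2
  have h3 : (∫ x, (Real.exp 2) ^ Z x ∂ν) ^ m ≤ Real.exp d := by
    calc _ ≤ Real.exp (q * Real.exp (2 * k)) ^ m :=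
          pow_le_pow_left₀ (integral_nonneg fun x => by positivity) h1 m
      _ = Real.exp (m * q * Real.exp (2 * k)) := by rw [← Real.exp_nat_mul]; ring_nf
      _ ≤ _ := Real.exp_le_exp.2 h
  calc (Measure.pi fun _ : Fin m => ν).real {ω | d ≤ ∑ i, Z (ω i)}
      = Real.exp (-(2 * d)) * ((Real.exp 2) ^ d *
          (Measure.pi fun _ : Fin m => ν).real {ω | d ≤ ∑ i, Z (ω i)}) := by
        rw [← mul_assoc, ← Real.exp_nat_mul, ← Real.exp_add]; ring_nf; simp
    _ ≤ Real.exp (-(2 * d)) * Real.exp d := by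
        gcongr
        exact h2.trans h3
    _ = _ := by rw [← Real.exp_add]; ring_nf

end ProductSpaces

/-! ### Independent draws and the cost of conditioning on distinctness. -/

theorem measureReal_pi_forall_mem_eq {α : Type*} [MeasurableSpace α] (μ : Measure α) [IsProbabilityMeasure μ]
    {k : ℕ} (s : Finset (Fin k)) (u : Fin k → α) :
    (Measure.pi fun _ : Fin k => μ).real {v | ∀ j ∈ s, v j = u j} = ∏ j ∈ s, μ.real {u j} := by
  classical
  have h : {v : Fin k → α | ∀ j ∈ s, v j = u j} =
      Set.pi Set.univ fun j => if j ∈ s then {u j} else Set.univ := by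
    ext v
    simp only [Set.mem_pi, Set.mem_univ, true_imp_iff]
    refine forall_congr' fun j => ?_
    by_cases hj : j ∈ s <;> simp [hj]
  rw [h, measureReal_def, Measure.pi_pi, ENNReal.toReal_prod]
  rw [← Finset.prod_subset (Finset.subset_univ s)]
  · exact Finset.prod_congr rfl fun j hj => by simp [hj, measureReal_def]
  · intro j _ hj
    simp [hj]

theorem measureReal_pi_apply_eq {α : Type*} [MeasurableSpace α] (μ : Measure α) [IsProbabilityMeasure μ]
    {k : ℕ} (j : Fin k) (x : α) :
    (Measure.pi fun _ : Fin k => μ).real {v | v j = x} = μ.real {x} := by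
  simpa using measureReal_pi_forall_mem_eq μ {j} fun _ => x

theorem measureReal_pi_two_eq {α : Type*} [MeasurableSpace α] (μ : Measure α) [IsProbabilityMeasure μ]
    {k : ℕ} {a b : Fin k} (hab : a ≠ b) (x : α) :
    (Measure.pi fun _ : Fin k => μ).real {v | v a = x ∧ v b = x} = μ.real {x} * μ.real {x} := by
  simpa [hab, pow_two] using measureReal_pi_forall_mem_eq μ {a, b} fun _ => x

section Sampling

variable {α : Type*} [Fintype α] [MeasurableSpace α] [MeasurableSingletonClass α]

theorem sum_measureReal_singleton_eq_one (μ : Measure α) [IsProbabilityMeasure μ] :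
    ∑ y, μ.real {y} = 1 := by
  rw [sum_measureReal_singleton]
  simp

/-- If `j` is one of `a`, `b`, two draws must equal `x`. Otherwise three separate positions are
involved, and summing over the common value `y` gives a factor ∑ p_y ^ 2 ≤ ρ. Keeping the factor
`μ.real {x}` makes the loss relative, hence usable for light variables too. -/
theorem measureReal_pi_apply_eq_and_collision_le (μ : Measure α) [IsProbabilityMeasure μ] {ρ : ℝ}
    (hρ : ∀ y, μ.real {y} ≤ ρ) {k : ℕ} (j : Fin k) {a b : Fin k} (hab : a ≠ b) (x : α) :
    (Measure.pi fun _ : Fin k => μ).real {v | v j = x ∧ v a = v b} ≤ μ.real {x} * ρ := by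
  classical
  have hx : μ.real {x} * μ.real {x} ≤ μ.real {x} * ρ :=
    mul_le_mul_of_nonneg_left (hρ x) measureReal_nonneg
  by_cases haj : a = j
  · subst haj
    refine le_trans (measureReal_mono fun v hv => ?_) ((measureReal_pi_two_eq μ hab x).trans_le hx)
    exact ⟨hv.1, hv.2.symm.trans hv.1⟩
  by_cases hbj : b = j
  · subst hbj
    refine le_trans (measureReal_mono fun v hv => ?_) ((measureReal_pi_two_eq μ hab x).trans_le hx)
    exact ⟨hv.2.trans hv.1, hv.1⟩
  have hsub : {v : Fin k → α | v j = x ∧ v a = v b} ⊆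
      ⋃ y ∈ (Finset.univ : Finset α),
        {v | ∀ i ∈ ({j, a, b} : Finset (Fin k)), v i = if i = j then x else y} := by
    intro v hv
    simp only [Finset.mem_univ, Set.iUnion_true, Set.mem_iUnion]
    refine ⟨v a, ?_⟩
    intro i hi
    simp only [Finset.mem_insert, Finset.mem_singleton] at hi
    rcases hi with rfl | rfl | rfl
    · simpa using hv.1
    · simp [haj]
    · simpa [hbj] using hv.2.symm
  calc _ ≤ _ := measureReal_mono hsub (measure_ne_top _ _)
    _ ≤ _ := measureReal_biUnion_finset_le _ _
    _ = ∑ y, μ.real {x} * (μ.real {y} * μ.real {y}) := by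
        refine Finset.sum_congr rfl fun y _ => ?_
        rw [measureReal_pi_forall_mem_eq, Finset.prod_insert, Finset.prod_insert,
          Finset.prod_singleton]
        · simp [haj, hbj]
        · simpa using hab
        · simp [Ne.symm haj, Ne.symm hbj]
    _ ≤ ∑ y, μ.real {x} * (ρ * μ.real {y}) := by
        gcongr with y
        exact hρ y
    _ = _ := by
        rw [← Finset.mul_sum, ← Finset.mul_sum, sum_measureReal_singleton_eq_one, mul_one]

theorem measureReal_pi_apply_eq_and_not_injective_le (μ : Measure α) [IsProbabilityMeasure μ]
    {ρ : ℝ} (hρ : ∀ y, μ.real {y} ≤ ρ) {k : ℕ} (j : Fin k) (x : α) :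
    (Measure.pi fun _ : Fin k => μ).real {v | v j = x ∧ ¬ Function.Injective v} ≤
      μ.real {x} * (k ^ 2 * ρ) := by
  classical
  have hρ0 : 0 ≤ ρ := measureReal_nonneg.trans (hρ x)
  have hsub : {v : Fin k → α | v j = x ∧ ¬ Function.Injective v} ⊆
      ⋃ ab ∈ (Finset.univ.filter fun ab : Fin k × Fin k => ab.1 ≠ ab.2),
        {v | v j = x ∧ v ab.1 = v ab.2} := by
    rintro v ⟨hv, hinj⟩
    simp only [Function.Injective, not_forall] at hinj
    obtain ⟨a, b, h, hne⟩ := hinj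
    simp only [Set.mem_iUnion]
    exact ⟨(a, b), by simpa using hne, hv, h⟩
  calc _ ≤ _ := measureReal_mono hsub (measure_ne_top _ _)
    _ ≤ _ := measureReal_biUnion_finset_le _ _
    _ ≤ ∑ ab ∈ (Finset.univ.filter fun ab : Fin k × Fin k => ab.1 ≠ ab.2), μ.real {x} * ρ :=
        Finset.sum_le_sum fun ab hab => measureReal_pi_apply_eq_and_collision_le μ hρ j
          (by simpa using hab) x
    _ ≤ ∑ ab : Fin k × Fin k, μ.real {x} * ρ :=
        Finset.sum_le_sum_of_subset_of_nonneg (Finset.filter_subset _ _) fun _ _ _ =>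
          mul_nonneg measureReal_nonneg hρ0
    _ = _ := by simp; ring

theorem measureReal_pi_not_injective_le (μ : Measure α) [IsProbabilityMeasure μ]
    {ρ : ℝ} (hρ : ∀ y, μ.real {y} ≤ ρ) {k : ℕ} (hk : 0 < k) :
    (Measure.pi fun _ : Fin k => μ).real {v | ¬ Function.Injective v} ≤ k ^ 2 * ρ := by
  have hsub : {v : Fin k → α | ¬ Function.Injective v} ⊆
      ⋃ x ∈ (Finset.univ : Finset α), {v | v ⟨0, hk⟩ = x ∧ ¬ Function.Injective v} := by
    intro v hv
    simp only [Set.mem_iUnion]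
    exact ⟨v ⟨0, hk⟩, Finset.mem_univ _, rfl, hv⟩
  calc _ ≤ _ := measureReal_mono hsub (measure_ne_top _ _)
    _ ≤ _ := measureReal_biUnion_finset_le _ _
    _ ≤ ∑ x, μ.real {x} * (k ^ 2 * ρ) :=
        Finset.sum_le_sum fun x _ => measureReal_pi_apply_eq_and_not_injective_le μ hρ _ x
    _ = _ := by rw [← Finset.sum_mul, sum_measureReal_singleton_eq_one, one_mul]

theorem half_le_measureReal_pi_injective (μ : Measure α) [IsProbabilityMeasure μ]
    {ρ : ℝ} (hρ : ∀ y, μ.real {y} ≤ ρ) {k : ℕ} (hk : 0 < k) (h : k ^ 2 * ρ ≤ 1 / 2) :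
    1 / 2 ≤ (Measure.pi fun _ : Fin k => μ).real {v | Function.Injective v} := by
  have h1 := measureReal_pi_not_injective_le μ hρ hk
  have h2 := probReal_add_probReal_compl (μ := Measure.pi fun _ : Fin k => μ)
    (s := {v | Function.Injective v}) (Set.toFinite _).measurableSet
  rw [show {v : Fin k → α | Function.Injective v}ᶜ = {v | ¬ Function.Injective v} from rfl] at h2
  linarith

end Sampling

/-! ### Occurrences of a fixed variable in a random clause. -/

/-- The number of literals of a clause whose variable is `x`. -/
def clauseOccurrences {n k : ℕ} (x : Fin n) (c : Clause n k) : ℕ :=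
  Finset.card {j : Fin k | c.1 j = x}

theorem clauseOccurrences_le {n k : ℕ} (x : Fin n) (c : Clause n k) :
    clauseOccurrences x c ≤ k :=
  (Finset.card_le_univ _).trans_eq (by simp)

theorem clauseOccurrences_ne_zero_iff {n k : ℕ} (x : Fin n) (c : Clause n k) :
    clauseOccurrences x c ≠ 0 ↔ ∃ j, c.1 j = x := by
  simp [clauseOccurrences, Finset.filter_eq_empty_iff]

theorem occurrences_eq_sum {n k m : ℕ} (Φ : Formula n k m) (x : Fin n) :
    occurrences Φ x = ∑ i, clauseOccurrences x (Φ i) := by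
  simp only [occurrences, clauseOccurrences, Finset.card_filter]
  rw [Fintype.sum_prod_type]

theorem card_filter_clauseOccurrences_ne_zero_le {n k : ℕ} (c : Clause n k) :
    Finset.card {x : Fin n | clauseOccurrences x c ≠ 0} ≤ k := by
  have : ({x : Fin n | clauseOccurrences x c ≠ 0} : Finset (Fin n)) ⊆
      Finset.univ.image c.1 := by
    intro x hx
    rw [Finset.mem_filter, clauseOccurrences_ne_zero_iff] at hx
    obtain ⟨j, hj⟩ := hx.2
    exact Finset.mem_image.2 ⟨j, Finset.mem_univ _, hj⟩
  exact (Finset.card_le_card this).trans (Finset.card_image_le.trans_eq (by simp))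

theorem varLaw_real_singleton {n : ℕ} {w : Fin n → ℝ} (hw : ∀ i, 0 < w i) (i : Fin n) :
    (varLaw w).real {i} = w i / ∑ j, w j := by
  have hS : 0 ≤ ∑ j, w j := Finset.sum_nonneg fun j _ => (hw j).le
  rw [measureReal_def, varLaw, Measure.finsetSum_apply]
  simp only [Measure.smul_apply, smul_eq_mul, Measure.dirac_apply, Set.indicator_apply,
    Set.mem_singleton_iff, Pi.one_apply, mul_ite, mul_one, mul_zero]
  simp only [Finset.sum_ite_eq', Finset.mem_univ, if_true]
  exact ENNReal.toReal_ofReal (div_nonneg (hw i).le hS)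

theorem isProbabilityMeasure_varLaw {n : ℕ} {w : Fin n → ℝ} (hn : 0 < n) (hw : ∀ i, 0 < w i) :
    IsProbabilityMeasure (varLaw w) := by
  have hne : Nonempty (Fin n) := ⟨⟨0, hn⟩⟩
  have hS : 0 < ∑ j, w j := Finset.sum_pos (fun j _ => hw j) Finset.univ_nonempty
  constructor
  rw [varLaw, Measure.finsetSum_apply]
  simp only [Measure.smul_apply, smul_eq_mul, measure_univ, mul_one]
  rw [← ENNReal.ofReal_sum_of_nonneg fun i _ => div_nonneg (hw i).le hS.le, ← Finset.sum_div,
    div_self hS.ne', ENNReal.ofReal_one]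

section ClauseLaw

variable {n k : ℕ} {w : Fin n → ℝ} {ρ : ℝ}

theorem isProbabilityMeasure_clauseLaw (hk : 0 < k) (hn : 0 < n) (hw : ∀ i, 0 < w i)
    (hρ : ∀ i, w i / ∑ j, w j ≤ ρ) (h : k ^ 2 * ρ ≤ 1 / 2) :
    IsProbabilityMeasure (clauseLaw k w) := by
  have := isProbabilityMeasure_varLaw hn hw
  have hinj := half_le_measureReal_pi_injective (varLaw w) (ρ := ρ)
    (fun i => (varLaw_real_singleton hw i).trans_le (hρ i)) hk h
  have : IsProbabilityMeasure
      (cond (Measure.pi fun _ : Fin k => varLaw w) {v | Function.Injective v}) := by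
    refine cond_isProbabilityMeasure fun h0 => ?_
    rw [measureReal_def, h0] at hinj
    norm_num at hinj
  unfold clauseLaw
  infer_instance

theorem clauseLaw_real_mem_eq (hn : 0 < n) (hw : ∀ i, 0 < w i) (x : Fin n) :
    (clauseLaw k w).real {c | clauseOccurrences x c ≠ 0} =
      ((Measure.pi fun _ : Fin k => varLaw w).real {v | Function.Injective v})⁻¹ *
        (Measure.pi fun _ : Fin k => varLaw w).real {v | Function.Injective v ∧ ∃ j, v j = x} := by
  have := isProbabilityMeasure_varLaw hn hw
  have hset : {c : Clause n k | clauseOccurrences x c ≠ 0} =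
      {v : Fin k → Fin n | ∃ j, v j = x} ×ˢ (Set.univ : Set (Fin k → Bool)) := by
    ext c
    simp [clauseOccurrences_ne_zero_iff]
  rw [hset, clauseLaw, measureReal_def, Measure.prod_prod, measure_univ, mul_one,
    cond_apply (Set.toFinite _).measurableSet, ENNReal.toReal_mul, ENNReal.toReal_inv]
  rfl

/-- Look only at the first position: it equals `x` with probability p_x, of which repeated draws
remove at most half. Dividing by the probability of distinctness only helps. -/
theorem half_mul_le_clauseLaw_real (hk : 0 < k) (hn : 0 < n) (hw : ∀ i, 0 < w i)
    (hρ : ∀ i, w i / ∑ j, w j ≤ ρ) (h : k ^ 2 * ρ ≤ 1 / 2) (x : Fin n) :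
    (w x / ∑ j, w j) / 2 ≤ (clauseLaw k w).real {c | clauseOccurrences x c ≠ 0} := by
  have := isProbabilityMeasure_varLaw hn hw
  have hρ' : ∀ i, (varLaw w).real {i} ≤ ρ := fun i => (varLaw_real_singleton hw i).trans_le (hρ i)
  have hinj := half_le_measureReal_pi_injective (varLaw w) hρ' hk h
  have hbad := measureReal_pi_apply_eq_and_not_injective_le (varLaw w) hρ' (⟨0, hk⟩ : Fin k) x
  rw [clauseLaw_real_mem_eq hn hw, ← varLaw_real_singleton hw]
  set V := Measure.pi fun _ : Fin k => varLaw w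
  set p := (varLaw w).real {x}
  have h1 : p ≤ V.real {v | Function.Injective v ∧ ∃ j, v j = x} +
      V.real {v | v ⟨0, hk⟩ = x ∧ ¬ Function.Injective v} := by
    rw [show p = V.real {v | v ⟨0, hk⟩ = x} from (measureReal_pi_apply_eq _ _ _).symm]
    refine (measureReal_mono fun v hv => ?_).trans (measureReal_union_le _ _)
    by_cases hi : Function.Injective v
    · exact Or.inl ⟨hi, _, hv⟩
    · exact Or.inr ⟨hv, hi⟩
  have hp : 0 ≤ p := measureReal_nonneg
  have h2 : p * (k ^ 2 * ρ) ≤ p * (1 / 2) := mul_le_mul_of_nonneg_left h hp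
  have h3 : 1 ≤ (V.real {v | Function.Injective v})⁻¹ :=
    (one_le_inv₀ (by linarith)).2 measureReal_le_one
  calc p / 2 ≤ V.real {v | Function.Injective v ∧ ∃ j, v j = x} := by linarith
    _ ≤ _ := le_mul_of_one_le_left measureReal_nonneg h3

/-- Union bound over the `k` positions; conditioning on an event of probability at least 1/2 at most
doubles the result. -/
theorem clauseLaw_real_le (hk : 0 < k) (hn : 0 < n) (hw : ∀ i, 0 < w i)
    (hρ : ∀ i, w i / ∑ j, w j ≤ ρ) (h : k ^ 2 * ρ ≤ 1 / 2) (x : Fin n) :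
    (clauseLaw k w).real {c | clauseOccurrences x c ≠ 0} ≤ 2 * k * (w x / ∑ j, w j) := by
  have := isProbabilityMeasure_varLaw hn hw
  have hinj := half_le_measureReal_pi_injective (varLaw w) (ρ := ρ)
    (fun i => (varLaw_real_singleton hw i).trans_le (hρ i)) hk h
  rw [clauseLaw_real_mem_eq hn hw, ← varLaw_real_singleton hw]
  set V := Measure.pi fun _ : Fin k => varLaw w
  have h1 : V.real {v | Function.Injective v ∧ ∃ j, v j = x} ≤ k * (varLaw w).real {x} := by
    calc _ ≤ V.real (⋃ j ∈ (Finset.univ : Finset (Fin k)), {v | v j = x}) := by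
          refine measureReal_mono (fun v hv => ?_) (measure_ne_top _ _)
          obtain ⟨-, j, hj⟩ := hv
          simp only [Set.mem_iUnion]
          exact ⟨j, Finset.mem_univ _, hj⟩
      _ ≤ _ := measureReal_biUnion_finset_le _ _
      _ = _ := by simp [V, measureReal_pi_apply_eq]
  have h2 : (V.real {v | Function.Injective v})⁻¹ ≤ 2 := by
    rw [inv_le_comm₀ (by linarith) (by norm_num)]
    linarith
  calc _ ≤ 2 * (k * (varLaw w).real {x}) := mul_le_mul h2 h1 measureReal_nonneg (by norm_num)
    _ = _ := by ring

end ClauseLaw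

/-! ### Consequences of the power law for the weights. -/

theorem wMin_le {n : ℕ} (w : Fin n → ℝ) (i : Fin n) : wMin w ≤ w i :=
  ciInf_le (Set.finite_range w).bddBelow i

theorem le_wMax {n : ℕ} (w : Fin n → ℝ) (i : Fin n) : w i ≤ wMax w :=
  le_ciSup (Set.finite_range w).bddAbove i

theorem tail_le_one {n : ℕ} (w : Fin n → ℝ) (v : ℝ) : tail w v ≤ 1 := by
  refine div_le_one_of_le₀ ?_ (Nat.cast_nonneg _)
  exact_mod_cast (Finset.card_le_univ _).trans_eq (by simp)

theorem card_filter_eq_mul_tail {n : ℕ} (hn : 0 < n) (w : Fin n → ℝ) (v : ℝ) :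
    (Finset.card {i : Fin n | v ≤ w i} : ℝ) = n * tail w v := by
  have : (n : ℝ) ≠ 0 := by positivity
  rw [tail]
  field_simp

namespace IsPowerLaw

variable {n : ℕ} {w : Fin n → ℝ} {K β : ℝ}

theorem inv_le (h : IsPowerLaw K β w) (i : Fin n) : K⁻¹ ≤ w i := by
  have := h.min_theta.1
  rw [mul_one] at this
  exact this.trans (wMin_le w i)

theorem pos (h : IsPowerLaw K β w) (hK : 1 ≤ K) (i : Fin n) : 0 < w i :=
  (inv_pos.2 (by linarith)).trans_le (h.inv_le i)

/-- Removes the range restriction on `v`. Below the minimum weight one has v ≤ K, so enlarging the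
constant to `K ^ β` makes the right side at least 1; above the maximum the tail vanishes. -/
theorem tail_le (h : IsPowerLaw K β w) (hK : 1 ≤ K) (hβ : 2 < β) {v : ℝ} (hv : 0 < v) :
    tail w v ≤ K ^ β * v ^ (1 - β) := by
  have hK0 : 0 < K := by linarith
  rcases lt_or_ge v (wMin w) with h1 | h1
  · have hvK : v ≤ K := by linarith [h.min_theta.2]
    calc tail w v ≤ 1 := tail_le_one w v
      _ ≤ K := hK
      _ = K ^ β * K ^ (1 - β) := by rw [← Real.rpow_add hK0]; simp
      _ ≤ _ := mul_le_mul_of_nonneg_left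
          (Real.rpow_le_rpow_of_nonpos hv hvK (by linarith)) (by positivity)
  rcases lt_or_ge (wMax w) v with h2 | h2
  · have : tail w v = 0 := by
      have : ({i : Fin n | v ≤ w i} : Finset (Fin n)) = ∅ := by
        ext i
        simpa using (le_wMax w i).trans_lt h2
      simp [tail, this]
    rw [this]
    positivity
  · refine (h.tail_theta v ⟨h1, h2⟩).2.trans ?_
    gcongr
    exact Real.self_le_rpow_of_one_le hK (by linarith)

theorem le_sum (h : IsPowerLaw K β w) : (n : ℝ) / K ≤ ∑ i, w i := by
  calc (n : ℝ) / K = ∑ _i : Fin n, K⁻¹ := by simp [div_eq_mul_inv]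
    _ ≤ _ := Finset.sum_le_sum fun i _ => h.inv_le i

/-- Layer-cake summation: a weight is at most 1 plus the number of positive integers below or equal
to it. The resulting sum of tails converges because β > 2. -/
theorem sum_le (h : IsPowerLaw K β w) (hK : 1 ≤ K) (hβ : 2 < β) (hn : 0 < n) :
    ∑ i, w i ≤ n * (1 + K ^ β * ∑' j : ℕ, (j : ℝ) ^ (1 - β)) := by
  set M := ⌊wMax w⌋₊
  have hsummable : Summable fun j : ℕ => (j : ℝ) ^ (1 - β) :=
    Real.summable_nat_rpow.2 (by linarith)
  have hi : ∀ i, w i ≤ 1 + ∑ j ∈ Finset.Icc 1 M, if (j : ℝ) ≤ w i then (1 : ℝ) else 0 := by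
    intro i
    have hwi := (h.pos hK i).le
    have : Finset.Icc 1 ⌊w i⌋₊ ⊆ {j ∈ Finset.Icc 1 M | (j : ℝ) ≤ w i} := by
      intro j hj
      rw [Finset.mem_Icc] at hj
      rw [Finset.mem_filter, Finset.mem_Icc]
      exact ⟨⟨hj.1, hj.2.trans (Nat.floor_le_floor (le_wMax w i))⟩, (Nat.le_floor_iff hwi).1 hj.2⟩
    have hcard := Finset.card_le_card this
    rw [Nat.card_Icc, Nat.add_sub_cancel] at hcard
    rw [← Finset.sum_filter, Finset.sum_const, nsmul_eq_mul, mul_one]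
    have h1 := Nat.lt_floor_add_one (w i)
    have h2 : ((⌊w i⌋₊ : ℕ) : ℝ) ≤ _ := Nat.cast_le.2 hcard
    linarith
  calc ∑ i, w i ≤ ∑ i, (1 + ∑ j ∈ Finset.Icc 1 M, if (j : ℝ) ≤ w i then (1 : ℝ) else 0) :=
        Finset.sum_le_sum fun i _ => hi i
    _ = n + ∑ j ∈ Finset.Icc 1 M, n * tail w j := by
        rw [Finset.sum_add_distrib, Finset.sum_comm]
        simp only [← card_filter_eq_mul_tail hn, Finset.card_filter]
        simp
    _ ≤ n + ∑ j ∈ Finset.Icc 1 M, n * (K ^ β * (j : ℝ) ^ (1 - β)) := by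
        gcongr with j hj
        exact h.tail_le hK hβ (by exact_mod_cast (Finset.mem_Icc.1 hj).1)
    _ = n * (1 + K ^ β * ∑ j ∈ Finset.Icc 1 M, (j : ℝ) ^ (1 - β)) := by
        rw [← Finset.mul_sum, ← Finset.mul_sum]; ring
    _ ≤ _ := by
        gcongr
        exact hsummable.sum_le_tsum _ fun j _ => by positivity

theorem div_sum_le (h : IsPowerLaw K β w) (hK : 1 ≤ K) (hn : 0 < n) (i : Fin n) :
    w i / ∑ j, w j ≤ K ^ 2 * (n : ℝ) ^ (1 / (β - 1) - 1) := by
  have hn' : (0 : ℝ) < n := by exact_mod_cast hn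
  have hK0 : 0 < K := by linarith
  calc w i / ∑ j, w j ≤ (K * (n : ℝ) ^ (1 / (β - 1))) / (n / K) := by
        have := h.le_sum
        have := (le_wMax w i).trans h.max_theta.2
        gcongr
    _ = _ := by
        rw [Real.rpow_sub_one hn'.ne']
        field_simp

theorem le_card (h : IsPowerLaw K β w) (hn : 0 < n) {v : ℝ}
    (h1 : wMin w ≤ v) (h2 : v ≤ wMax w) :
    K⁻¹ * (n * v ^ (1 - β)) ≤ (Finset.card {i : Fin n | v ≤ w i} : ℝ) := by
  rw [card_filter_eq_mul_tail hn]
  have := mul_le_mul_of_nonneg_left (h.tail_theta v ⟨h1, h2⟩).1 (Nat.cast_nonneg (α := ℝ) n)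
  linarith

theorem card_le (h : IsPowerLaw K β w) (hK : 1 ≤ K) (hβ : 2 < β) (hn : 0 < n) {v : ℝ}
    (hv : 0 < v) :
    (Finset.card {i : Fin n | v ≤ w i} : ℝ) ≤ K ^ β * (n * v ^ (1 - β)) := by
  rw [card_filter_eq_mul_tail hn]
  have := mul_le_mul_of_nonneg_left (h.tail_le hK hβ hv) (Nat.cast_nonneg (α := ℝ) n)
  linarith

end IsPowerLaw

/-! ### Elementary estimates. -/

theorem eventually_mul_rpow_le_half {β : ℝ} (hβ : 2 < β) (A : ℝ) :
    ∃ n₀ : ℕ, ∀ n : ℕ, n₀ ≤ n → A * (n : ℝ) ^ (1 / (β - 1) - 1) ≤ 1 / 2 := by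
  have hneg : 0 < 1 - 1 / (β - 1) := by
    rw [sub_pos, div_lt_one (by linarith)]
    linarith
  have h := ((tendsto_rpow_neg_atTop hneg).comp tendsto_natCast_atTop_atTop).const_mul A
  rw [mul_zero] at h
  obtain ⟨n₀, hn₀⟩ := Filter.eventually_atTop.1 (h.eventually (ge_mem_nhds (by norm_num :
    (0 : ℝ) < 1 / 2)))
  exact ⟨n₀, fun n hn => by simpa using hn₀ n hn⟩

theorem rpow_le_mul_exp {γ x : ℝ} (hγ : 0 < γ) (hx : 0 ≤ x) :
    x ^ γ ≤ γ ^ γ * Real.exp x := by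
  have h1 : x / γ ≤ Real.exp (x / γ) := by linarith [Real.add_one_le_exp (x / γ)]
  have h2 : (x / γ) ^ γ ≤ Real.exp x := by
    calc (x / γ) ^ γ ≤ Real.exp (x / γ) ^ γ := Real.rpow_le_rpow (by positivity) h1 hγ.le
      _ = _ := by rw [← Real.exp_mul]; field_simp
  rw [Real.div_rpow hx hγ.le, div_le_iff₀ (by positivity)] at h2
  linarith

theorem measureReal_biUnion_finset_le_card_mul {Ω ι : Type*} [MeasurableSpace Ω] [Fintype ι]
    (μ : Measure Ω) (A : ι → Set Ω) (s : Finset ι) {e : ℝ} (he : 0 ≤ e) (h : ∀ x ∈ s, μ.real (A x) ≤ e) :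
    μ.real (⋃ x ∈ s, A x) ≤ Fintype.card ι * e := by
  calc _ ≤ ∑ x ∈ s, μ.real (A x) := measureReal_biUnion_finset_le _ _
    _ ≤ ∑ x ∈ s, e := Finset.sum_le_sum h
    _ = s.card * e := by simp
    _ ≤ _ := by
        gcongr
        exact Finset.card_le_univ s

/-! ### From tails of single variables to the number of variables above a threshold. -/

section Counting

variable {Ω : Type*} [MeasurableSpace Ω] [Finite Ω] [MeasurableSingletonClass Ω]
  {ι : Type*} [Fintype ι]

variable (μ : Measure Ω) [IsProbabilityMeasure μ] (X : ι → Ω → ℕ) (d : ℕ) (S T : Finset ι)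
  {e : ℝ} (he : 0 ≤ e) (hS : ∀ x ∈ S, μ.real {ω | X x ω < d} ≤ e)
  (hT : ∀ x ∉ T, μ.real {ω | d ≤ X x ω} ≤ e)

omit [Finite Ω] [MeasurableSingletonClass Ω] in
include he hS hT in
-- Unless some member of `S` falls short or some non-member of `T` reaches `d`, the counted set lies
-- between `S` and `T`.
theorem measureReal_card_not_mem_Icc_le_union :
    μ.real {ω | ¬ (S.card ≤ Finset.card {x | d ≤ X x ω} ∧ Finset.card {x | d ≤ X x ω} ≤ T.card)} ≤
      2 * (Fintype.card ι * e) := by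
  classical
  have hsub : {ω | ¬ (S.card ≤ Finset.card {x | d ≤ X x ω} ∧
      Finset.card {x | d ≤ X x ω} ≤ T.card)} ⊆
      (⋃ x ∈ S, {ω | X x ω < d}) ∪ ⋃ x ∈ Tᶜ, {ω | d ≤ X x ω} := by
    intro ω hω
    by_contra hcon
    simp only [Set.mem_union, Set.mem_iUnion, not_or, not_exists] at hcon
    refine hω ⟨Finset.card_le_card fun x hx => ?_, Finset.card_le_card fun x hx => ?_⟩
    · rw [Finset.mem_filter]
      exact ⟨Finset.mem_univ _, not_lt.1 (hcon.1 x hx)⟩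
    · by_contra hxT
      exact hcon.2 x (Finset.mem_compl.2 hxT) (Finset.mem_filter.1 hx).2
  calc _ ≤ _ := measureReal_mono hsub (measure_ne_top _ _)
    _ ≤ _ := measureReal_union_le _ _
    _ ≤ Fintype.card ι * e + Fintype.card ι * e := add_le_add
        (measureReal_biUnion_finset_le_card_mul μ _ S he hS)
        (measureReal_biUnion_finset_le_card_mul μ _ Tᶜ he fun x hx =>
          hT x (Finset.mem_compl.1 hx))
    _ = _ := by ring

theorem integral_card_filter :
    ∫ ω, (Finset.card {x | d ≤ X x ω} : ℝ) ∂μ = ∑ x, μ.real {ω | d ≤ X x ω} := by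
  simp only [Finset.card_filter, Nat.cast_sum]
  rw [integral_finsetSum _ fun x _ => Integrable.of_finite]
  refine Finset.sum_congr rfl fun x _ => ?_
  rw [← integral_indicator_one (Set.toFinite _).measurableSet]
  refine integral_congr_ae (Filter.Eventually.of_forall fun ω => ?_)
  by_cases h : d ≤ X x ω <;> simp [Set.indicator, h]

include hS in
theorem card_mul_le_integral_card_filter :
    S.card * (1 - e) ≤ ∫ ω, (Finset.card {x | d ≤ X x ω} : ℝ) ∂μ := by
  rw [integral_card_filter]
  calc _ = ∑ x ∈ S, (1 - e) := by simp [mul_sub]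
    _ ≤ ∑ x ∈ S, μ.real {ω | d ≤ X x ω} := by
        refine Finset.sum_le_sum fun x hx => ?_
        have h1 := hS x hx
        have h2 := probReal_add_probReal_compl (μ := μ) (s := {ω | X x ω < d})
          (Set.toFinite _).measurableSet
        rw [show {ω | X x ω < d}ᶜ = {ω | d ≤ X x ω} by ext; simp] at h2
        linarith
    _ ≤ _ := Finset.sum_le_sum_of_subset_of_nonneg (Finset.subset_univ _)
        fun _ _ _ => measureReal_nonneg

include he hT in
theorem integral_card_filter_le :
    ∫ ω, (Finset.card {x | d ≤ X x ω} : ℝ) ∂μ ≤ T.card + Fintype.card ι * e := by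
  classical
  rw [integral_card_filter, ← Finset.sum_add_sum_compl T]
  refine add_le_add ?_ ?_
  · calc _ ≤ ∑ x ∈ T, (1 : ℝ) := Finset.sum_le_sum fun x _ => measureReal_le_one
      _ = _ := by simp
  · calc _ ≤ ∑ x ∈ Tᶜ, e := Finset.sum_le_sum fun x hx => hT x (Finset.mem_compl.1 hx)
      _ = (Tᶜ.card : ℝ) * e := by simp
      _ ≤ _ := by
        gcongr
        exact Finset.card_le_univ _

include he hS hT in
-- The same two tail bounds place the expected count between |S|(1 - e) and |T| + |ι| e; Chebyshev
-- handles the deviation `t`.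
theorem measureReal_card_not_mem_Icc_le_variance {V t : ℝ} (ht : 0 < t)
    (hV : Var[fun ω => (Finset.card {x | d ≤ X x ω} : ℝ); μ] ≤ V) :
    μ.real {ω | ¬ (S.card * (1 - e) - t ≤ (Finset.card {x | d ≤ X x ω} : ℝ) ∧
      (Finset.card {x | d ≤ X x ω} : ℝ) ≤ T.card + Fintype.card ι * e + t)} ≤ V / t ^ 2 := by
  refine le_trans (measureReal_mono (fun ω hω => ?_) (measure_ne_top _ _))
    (measureReal_abs_sub_integral_ge_le μ _ hV ht)
  by_contra hcon
  rw [Set.mem_ofPred_eq, not_le, abs_lt] at hcon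
  have h2 := card_mul_le_integral_card_filter μ X d S hS
  have h3 := integral_card_filter_le μ X d T he hT
  exact hω ⟨by linarith [hcon.1], by linarith [hcon.2]⟩

end Counting

/-! ### Effect of replacing one clause. -/

section BoundedDifferences

variable {n k m : ℕ}

/-- Only the at most `k` variables of the new clause can gain occurrences. Undoing the replacement
gives the reverse inequality. -/
theorem numAtLeast_update_le (Φ : Formula n k m) (i : Fin m) (c : Clause n k) (d : ℝ) :
    numAtLeast (Function.update Φ i c) d ≤ numAtLeast Φ d + k := by
  classical
  have hsub : ({x : Fin n | d ≤ (occurrences (Function.update Φ i c) x : ℝ)} : Finset (Fin n)) ⊆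
      ({x : Fin n | d ≤ (occurrences Φ x : ℝ)} : Finset (Fin n)) ∪
        ({x : Fin n | clauseOccurrences x c ≠ 0} : Finset (Fin n)) := by
    intro x hx
    by_cases hc : clauseOccurrences x c = 0
    · have hle : occurrences (Function.update Φ i c) x ≤ occurrences Φ x := by
        rw [occurrences_eq_sum, occurrences_eq_sum]
        refine Finset.sum_le_sum fun j _ => ?_
        by_cases hj : j = i
        · subst hj
          simp [hc]
        · simp [Function.update_of_ne hj]
      refine Finset.mem_union_left _ ?_
      rw [Finset.mem_filter] at hx ⊢
      exact ⟨hx.1, hx.2.trans (Nat.cast_le.2 hle)⟩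
    · exact Finset.mem_union_right _ (Finset.mem_filter.2 ⟨Finset.mem_univ _, hc⟩)
  calc _ ≤ _ := Finset.card_le_card hsub
    _ ≤ _ := Finset.card_union_le _ _
    _ ≤ _ := Nat.add_le_add_left (card_filter_clauseOccurrences_ne_zero_le c) _

theorem abs_numAtLeast_update_sub_le (Φ : Formula n k m) (i : Fin m) (c : Clause n k) (d : ℝ) :
    |(numAtLeast (Function.update Φ i c) d : ℝ) - numAtLeast Φ d| ≤ k := by
  have h1 := numAtLeast_update_le Φ i c d
  have h2 := numAtLeast_update_le (Function.update Φ i c) i (Φ i) d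
  rw [Function.update_idem, Function.update_eq_self] at h2
  have h1' : (numAtLeast (Function.update Φ i c) d : ℝ) ≤ numAtLeast Φ d + k := by exact_mod_cast h1
  have h2' : (numAtLeast Φ d : ℝ) ≤ numAtLeast (Function.update Φ i c) d + k := by exact_mod_cast h2
  rw [abs_le]
  constructor <;> linarith

theorem variance_numAtLeast_le (w : Fin n → ℝ) [IsProbabilityMeasure (clauseLaw k w)] (d : ℝ) :
    Var[fun Φ => (numAtLeast Φ d : ℝ); formulaLaw k m w] ≤ m * (k : ℝ) ^ 2 :=
  variance_pi_le_of_bounded_differences (clauseLaw k w) m (fun Φ => (numAtLeast Φ d : ℝ))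
    fun Φ i c => abs_numAtLeast_update_sub_le Φ i c d

end BoundedDifferences

/-! ### Interpolation between the Chebyshev and union bounds. -/

/-- In P ^ 3 * P the powers of `n` combine to n ^ (-2) and the exponentials to exp(d/2 - d); fourth
roots give n ^ (-1/2) and exp(-d/8). -/
theorem le_of_le_exp_div_of_le_mul_exp {P A : ℝ} {n d : ℕ} (hn : 0 < n) (hP : 0 ≤ P) (hA : 1 ≤ A)
    (h1 : P ≤ A * (Real.exp (d / 6) / n)) (h2 : P ≤ 2 * (n * Real.exp (-d))) :
    P ≤ 2 * A * ((√n)⁻¹ * Real.exp (-(1 / 8)) ^ d) := by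
  have hn' : (0 : ℝ) < n := by exact_mod_cast hn
  refine le_of_pow_le_pow_left₀ (n := 4) (by norm_num) (by positivity) ?_
  have hsq : (√(n : ℝ)) ^ 4 = (n : ℝ) ^ 2 := by
    rw [show 4 = 2 * 2 from rfl, pow_mul, Real.sq_sqrt hn'.le]
  have hA4 : 2 * A ^ 3 ≤ 16 * A ^ 4 := by
    have : A ^ 3 ≤ A ^ 4 := pow_le_pow_right₀ hA (by norm_num)
    have : 0 ≤ A ^ 3 := by positivity
    linarith
  calc P ^ 4 = P ^ 3 * P := by ring
    _ ≤ (A * (Real.exp (d / 6) / n)) ^ 3 * (2 * (n * Real.exp (-d))) := by gcongr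
    _ = 2 * A ^ 3 * ((n : ℝ) ^ 2)⁻¹ * (Real.exp (d / 6) ^ 3 * Real.exp (-d)) := by
        field_simp
    _ = 2 * A ^ 3 * ((n : ℝ) ^ 2)⁻¹ * Real.exp (-(d / 2)) := by
        rw [← Real.exp_nat_mul, ← Real.exp_add]
        congr 2
        push_cast
        ring
    _ ≤ 16 * A ^ 4 * ((n : ℝ) ^ 2)⁻¹ * Real.exp (-(d / 2)) := by gcongr
    _ = 16 * A ^ 4 * ((n : ℝ) ^ 2)⁻¹ * (Real.exp (-(1 / 8)) ^ d) ^ 4 := by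
        rw [← Real.exp_nat_mul, ← Real.exp_nat_mul]
        congr 2
        push_cast
        ring
    _ = _ := by
        rw [← hsq]
        ring

theorem exp_neg_le_mul_rpow {β : ℝ} (hβ : 2 < β) {d : ℕ} (hd : 1 ≤ d) :
    Real.exp (-d) ≤ (β - 1) ^ (β - 1) * (d : ℝ) ^ (1 - β) := by
  have hd0 : (0 : ℝ) < d := by exact_mod_cast hd
  have h := rpow_le_mul_exp (γ := β - 1) (by linarith) hd0.le
  rw [show 1 - β = -(β - 1) by ring, Real.rpow_neg hd0.le, Real.exp_neg]
  rw [← div_eq_mul_inv, le_div_iff₀ (by positivity), inv_mul_le_iff₀ (Real.exp_pos _)]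
  linarith

/-- Turns Chebyshev's polynomial loss into an exponential slow enough that its cube is still beaten
by exp(-d). -/
theorem inv_sq_rpow_le_mul_exp {β : ℝ} (hβ : 2 < β) {d : ℕ} (hd : 1 ≤ d) :
    (((d : ℝ) ^ (1 - β)) ^ 2)⁻¹ ≤
      6 ^ (2 * β - 2) * (2 * β - 2) ^ (2 * β - 2) * Real.exp (d / 6) := by
  have hd0 : (0 : ℝ) < d := by exact_mod_cast hd
  have h := rpow_le_mul_exp (γ := 2 * β - 2) (x := d / 6) (by linarith) (by positivity)
  calc (((d : ℝ) ^ (1 - β)) ^ 2)⁻¹ = (d : ℝ) ^ (2 * β - 2) := by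
        rw [← Real.rpow_natCast, ← Real.rpow_mul hd0.le, ← Real.rpow_neg hd0.le]
        congr 1
        push_cast
        ring
    _ = 6 ^ (2 * β - 2) * ((d : ℝ) / 6) ^ (2 * β - 2) := by
        rw [← Real.mul_rpow (by norm_num) (by positivity)]
        congr 1
        ring
    _ ≤ _ := by
        rw [mul_assoc]
        gcongr

/-! ### Occurrences in the whole formula, and a single threshold. -/

section Occurrences

variable {n k m : ℕ} {w : Fin n → ℝ} {K β : ℝ}

theorem div_le_mul_clauseLaw_real (h : IsPowerLaw K β w) (hK : 1 ≤ K) (hβ : 2 < β) (hk : 0 < k)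
    (hn : 0 < n) (hm : K⁻¹ * (n : ℝ) ≤ m)
    (hρ : (k : ℝ) ^ 2 * (K ^ 2 * (n : ℝ) ^ (1 / (β - 1) - 1)) ≤ 1 / 2) (x : Fin n) :
    w x / (2 * K * (1 + K ^ β * ∑' j : ℕ, (j : ℝ) ^ (1 - β))) ≤
      m * (clauseLaw k w).real {c | clauseOccurrences x c ≠ 0} := by
  have hn' : (0 : ℝ) < n := by exact_mod_cast hn
  have hK0 : 0 < K := by linarith
  have hW := h.sum_le hK hβ hn
  have hW0 : 0 < ∑ j, w j := lt_of_lt_of_le (by positivity) h.le_sum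
  have hw := h.pos hK x
  have htsum : 0 ≤ ∑' j : ℕ, (j : ℝ) ^ (1 - β) := tsum_nonneg fun j => by positivity
  set c := 1 + K ^ β * ∑' j : ℕ, (j : ℝ) ^ (1 - β)
  have hc : 0 < c := by positivity
  have hq := half_mul_le_clauseLaw_real hk hn (h.pos hK) (h.div_sum_le hK hn) hρ x
  calc w x / (2 * K * c) = K⁻¹ * n * ((w x / (n * c)) / 2) := by field_simp
    _ ≤ m * ((w x / ∑ j, w j) / 2) := by gcongr
    _ ≤ _ := by gcongr

theorem mul_clauseLaw_real_le (h : IsPowerLaw K β w) (hK : 1 ≤ K) (hk : 0 < k)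
    (hn : 0 < n) (hm : (m : ℝ) ≤ K * n)
    (hρ : (k : ℝ) ^ 2 * (K ^ 2 * (n : ℝ) ^ (1 / (β - 1) - 1)) ≤ 1 / 2) (x : Fin n) :
    m * (clauseLaw k w).real {c | clauseOccurrences x c ≠ 0} ≤ 2 * k * K ^ 2 * w x := by
  have hn' : (0 : ℝ) < n := by exact_mod_cast hn
  have hK0 : 0 < K := by linarith
  have hW := h.le_sum
  have hw := h.pos hK x
  have hq := clauseLaw_real_le hk hn (h.pos hK) (h.div_sum_le hK hn) hρ x
  calc _ ≤ (K * n) * (2 * k * (w x / ∑ j, w j)) := by gcongr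
    _ ≤ (K * n) * (2 * k * (w x / (n / K))) := by gcongr
    _ = _ := by field_simp

theorem formulaLaw_real_occurrences_lt_le [IsProbabilityMeasure (clauseLaw k w)] (x : Fin n) (d : ℕ)
    (h : 4 * (d : ℝ) ≤ m * (clauseLaw k w).real {c | clauseOccurrences x c ≠ 0}) :
    (formulaLaw k m w).real {Φ | occurrences Φ x < d} ≤ Real.exp (-d) := by
  simp only [occurrences_eq_sum]
  exact measureReal_sum_lt_le (clauseLaw k w) (clauseOccurrences x) m d h

theorem formulaLaw_real_le_occurrences_le [IsProbabilityMeasure (clauseLaw k w)] (x : Fin n) (d : ℕ)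
    (h : m * (clauseLaw k w).real {c | clauseOccurrences x c ≠ 0} * Real.exp (2 * k) ≤ d) :
    (formulaLaw k m w).real {Φ | d ≤ occurrences Φ x} ≤ Real.exp (-d) := by
  simp only [occurrences_eq_sum]
  exact measureReal_le_sum_le (clauseLaw k w) (clauseOccurrences x) m d k
    (clauseOccurrences_le x) h

theorem numAtLeast_natCast (Φ : Formula n k m) (d : ℕ) :
    numAtLeast Φ d = Finset.card {x : Fin n | d ≤ occurrences Φ x} := by
  simp [numAtLeast]

end Occurrences

instance {n k m : ℕ} (w : Fin n → ℝ) [IsProbabilityMeasure (clauseLaw k w)] :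
    IsProbabilityMeasure (formulaLaw k m w) := by
  unfold formulaLaw
  infer_instance

/-- For a single threshold `d`, the number of variables of degree at least `d` is of order
`n * d ^ (1 - β)` except with a probability of order `n ^ (-1 / 2)` that decays exponentially
in `d`. -/
theorem exists_formulaLaw_real_numAtLeast_le (k : ℕ) (hk : 0 < k) (β : ℝ) (hβ : 2 < β) (K : ℝ)
    (hK : 1 ≤ K) :
    ∃ C s U A : ℝ, K ≤ C ∧ 0 < s ∧ 0 < U ∧ 0 ≤ A ∧ ∀ (n m : ℕ) (w : Fin n → ℝ), 0 < n →
      IsPowerLaw K β w → ThetaWith K (m : ℝ) (n : ℝ) →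
      (k : ℝ) ^ 2 * (K ^ 2 * (n : ℝ) ^ (1 / (β - 1) - 1)) ≤ 1 / 2 →
      ∀ d : ℕ, 1 ≤ d → C * d ≤ wMax w →
        (formulaLaw k m w).real {Φ | ¬ (s * (n * (d : ℝ) ^ (1 - β)) ≤ (numAtLeast Φ d : ℝ) ∧
          (numAtLeast Φ d : ℝ) ≤ U * (n * (d : ℝ) ^ (1 - β)))} ≤
          A * ((√n)⁻¹ * Real.exp (-(1 / 8)) ^ d) := by
  have hK0 : 0 < K := by linarith
  have hk0 : (0 : ℝ) < k := by exact_mod_cast hk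
  have htsum : 0 ≤ ∑' j : ℕ, (j : ℝ) ^ (1 - β) := tsum_nonneg fun j => by positivity
  obtain ⟨a, ha⟩ : ∃ a, a = 2 * K * (1 + K ^ β * ∑' j : ℕ, (j : ℝ) ^ (1 - β)) := ⟨_, rfl⟩
  have ha0 : 0 < a := by rw [ha]; positivity
  -- The summand `4 * a` gives weights above `C * d` the factor 4 needed in the lower Chernoff
  -- bound; `K` ensures C d ≥ w_min, where the power law applies.
  obtain ⟨C, hC⟩ : ∃ C, C = K + 4 * a := ⟨_, rfl⟩
  have hC0 : 0 < C := by rw [hC]; positivity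
  -- Chosen so that weights below `c * d` meet the hypothesis of the upper Chernoff bound.
  obtain ⟨c, hc⟩ : ∃ c, c = (2 * k * K ^ 2 * Real.exp (2 * k))⁻¹ := ⟨_, rfl⟩
  have hc0 : 0 < c := by rw [hc]; positivity
  obtain ⟨s₀, hs₀⟩ : ∃ s₀, s₀ = K⁻¹ * C ^ (1 - β) := ⟨_, rfl⟩
  have hs₀0 : 0 < s₀ := by rw [hs₀]; positivity
  obtain ⟨t₀, ht₀⟩ : ∃ t₀, t₀ = K ^ β * c ^ (1 - β) := ⟨_, rfl⟩
  have ht₀0 : 0 < t₀ := by rw [ht₀]; positivity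
  obtain ⟨B, hB⟩ : ∃ B, B = (β - 1) ^ (β - 1) := ⟨_, rfl⟩
  have hB0 : 0 < B := by rw [hB]; exact Real.rpow_pos_of_pos (by linarith) _
  obtain ⟨B', hB'⟩ : ∃ B' : ℝ, B' = 6 ^ (2 * β - 2) * (2 * β - 2) ^ (2 * β - 2) := ⟨_, rfl⟩
  have hB'0 : 0 < B' := by
    rw [hB']; exact mul_pos (by positivity) (Real.rpow_pos_of_pos (by linarith) _)
  obtain ⟨A, hA⟩ : ∃ A, A = 1 + 16 * K * k ^ 2 / s₀ ^ 2 * B' := ⟨_, rfl⟩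
  have hA1 : 1 ≤ A := by rw [hA, le_add_iff_nonneg_right]; positivity
  refine ⟨C, s₀ / 4, t₀ + B + s₀ / 4, 2 * A, by linarith, by positivity, by positivity,
    by positivity, ?_⟩
  intro n m w hn h hm hρ d hd hdC
  have hn' : (0 : ℝ) < n := by exact_mod_cast hn
  have hd' : (1 : ℝ) ≤ d := by exact_mod_cast hd
  have hd0 : (0 : ℝ) < d := by linarith
  have := isProbabilityMeasure_clauseLaw hk hn (h.pos hK) (h.div_sum_le hK hn) hρ
  obtain ⟨y, hy⟩ : ∃ y, y = (n : ℝ) * (d : ℝ) ^ (1 - β) := ⟨_, rfl⟩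
  have hy0 : 0 < y := by rw [hy]; positivity
  have hS : ∀ x ∈ ({x : Fin n | C * d ≤ w x} : Finset (Fin n)),
      (formulaLaw k m w).real {Φ | occurrences Φ x < d} ≤ Real.exp (-d) := by
    intro x hx
    have hx' : C * d ≤ w x := (Finset.mem_filter.1 hx).2
    refine formulaLaw_real_occurrences_lt_le x d (le_trans ?_
      (div_le_mul_clauseLaw_real h hK hβ hk hn hm.1 hρ x))
    rw [← ha, le_div_iff₀ ha0]
    have : 4 * a * d ≤ C * d := by gcongr; linarith
    linarith
  have hT : ∀ x ∉ ({x : Fin n | c * d ≤ w x} : Finset (Fin n)),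
      (formulaLaw k m w).real {Φ | d ≤ occurrences Φ x} ≤ Real.exp (-d) := by
    intro x hx
    have hx' : w x < c * d := by simpa using hx
    refine formulaLaw_real_le_occurrences_le x d ?_
    calc _ ≤ 2 * k * K ^ 2 * w x * Real.exp (2 * k) := by
          exact mul_le_mul_of_nonneg_right (mul_clauseLaw_real_le h hK hk hn hm.2 hρ x)
            (Real.exp_pos _).le
      _ ≤ 2 * k * K ^ 2 * (c * d) * Real.exp (2 * k) := by gcongr
      _ = d := by rw [hc]; field_simp
  have hScard := h.le_card hn (v := C * d) (by
    have h1 := h.min_theta.2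
    have h2 : K * 1 ≤ C * d := by gcongr; linarith
    linarith) hdC
  have hTcard := h.card_le hK hβ hn (v := c * d) (by positivity)
  rw [Real.mul_rpow hC0.le hd0.le, show K⁻¹ * (n * (C ^ (1 - β) * (d : ℝ) ^ (1 - β))) = s₀ * y by
    rw [hs₀, hy]; ring] at hScard
  rw [Real.mul_rpow hc0.le hd0.le, show K ^ β * (n * (c ^ (1 - β) * (d : ℝ) ^ (1 - β))) = t₀ * y by
    rw [ht₀, hy]; ring] at hTcard
  have hexp := exp_neg_le_mul_rpow hβ hd
  have hexp_half : Real.exp (-d) ≤ 1 / 2 := by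
    rw [Real.exp_neg, inv_le_comm₀ (Real.exp_pos _) (by norm_num)]
    linarith [Real.add_one_le_exp (d : ℝ)]
  have hnexp : n * Real.exp (-d) ≤ B * y := by
    calc _ ≤ n * ((β - 1) ^ (β - 1) * (d : ℝ) ^ (1 - β)) := by gcongr
      _ = _ := by rw [hB, hy]; ring
  rw [← hy]
  set S : Finset (Fin n) := {x : Fin n | C * d ≤ w x}
  set T : Finset (Fin n) := {x : Fin n | c * d ≤ w x}
  refine le_of_le_exp_div_of_le_mul_exp hn measureReal_nonneg hA1 ?_ ?_
  -- Chebyshev with deviation `s₀ / 4 * y`: the expectation is at least `s₀ / 2 * y`, so a quarter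
  -- survives.
  · have hvar : Var[fun Φ => (Finset.card {x : Fin n | d ≤ occurrences Φ x} : ℝ);
        formulaLaw k m w] ≤ m * (k : ℝ) ^ 2 := by
      simpa only [numAtLeast_natCast] using variance_numAtLeast_le (k := k) (m := m) w (d : ℝ)
    have hcheb := measureReal_card_not_mem_Icc_le_variance (formulaLaw k m w)
      (fun x Φ => occurrences Φ x) d S T (Real.exp_pos _).le hS hT (t := s₀ / 4 * y)
      (by positivity) hvar
    refine (measureReal_mono (fun Φ hΦ => ?_) (measure_ne_top _ _)).trans (hcheb.trans ?_)
    · intro hcon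
      refine hΦ ?_
      rw [numAtLeast_natCast]
      rw [Fintype.card_fin] at hcon
      have hhalf : (S.card : ℝ) * (1 / 2) ≤ S.card * (1 - Real.exp (-d)) := by
        gcongr
        linarith
      exact ⟨by linarith [hcon.1], by linarith [hcon.2]⟩
    · calc m * (k : ℝ) ^ 2 / (s₀ / 4 * y) ^ 2 ≤ K * n * (k : ℝ) ^ 2 / (s₀ / 4 * y) ^ 2 := by
            gcongr
            exact hm.2
        _ = 16 * K * k ^ 2 / s₀ ^ 2 * ((((d : ℝ) ^ (1 - β)) ^ 2)⁻¹ / n) := by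
            rw [hy]
            field_simp
            norm_num
        _ ≤ 16 * K * k ^ 2 / s₀ ^ 2 * ((B' * Real.exp (d / 6)) / n) := by
            gcongr
            rw [hB']
            exact inv_sq_rpow_le_mul_exp hβ hd
        _ = (16 * K * k ^ 2 / s₀ ^ 2 * B') * (Real.exp (d / 6) / n) := by ring
        _ ≤ _ := by
            gcongr
            linarith
  · have hunion := measureReal_card_not_mem_Icc_le_union (formulaLaw k m w)
      (fun x Φ => occurrences Φ x) d S T (Real.exp_pos _).le hS hT
    rw [Fintype.card_fin] at hunion
    refine (measureReal_mono (fun Φ hΦ => ?_) (measure_ne_top _ _)).trans hunion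
    intro hcon
    refine hΦ ?_
    rw [numAtLeast_natCast]
    have h1 : (S.card : ℝ) ≤ _ := Nat.cast_le.2 hcon.1
    have h2 : _ ≤ (T.card : ℝ) := Nat.cast_le.2 hcon.2
    have h3 : 0 < s₀ * y := by positivity
    have h4 : 0 < B * y := by positivity
    exact ⟨by linarith, by linarith⟩

/-! ### From integer to real thresholds, and the final union bound. -/

theorem numAtLeast_natCeil {n k m : ℕ} (Φ : Formula n k m) (d : ℝ) :
    numAtLeast Φ (⌈d⌉₊ : ℝ) = numAtLeast Φ d := by
  simp only [numAtLeast, Nat.cast_le, Nat.ceil_le]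

/-- It suffices to control the thresholds `d` that are natural numbers. -/
theorem numAtLeast_theta_of_nat {n k m : ℕ} (Φ : Formula n k m) {β s U L : ℝ} (hβ : 2 < β)
    (hs : 0 < s) (hL : 2 ^ (β - 1) / s ≤ L) (hU : U ≤ L) {d : ℝ} (hd : 1 ≤ d)
    (h : s * (n * (⌈d⌉₊ : ℝ) ^ (1 - β)) ≤ (numAtLeast Φ (⌈d⌉₊ : ℝ) : ℝ) ∧
      (numAtLeast Φ (⌈d⌉₊ : ℝ) : ℝ) ≤ U * (n * (⌈d⌉₊ : ℝ) ^ (1 - β))) :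
    ThetaWith L (numAtLeast Φ d : ℝ) (n * d ^ (1 - β)) := by
  have hd0 : 0 < d := by linarith
  have hc1 : d ≤ ⌈d⌉₊ := Nat.le_ceil d
  -- This uses d ≥ 1. Rounding up thus costs the factor 2 ^ (β - 1) in the lower bound and nothing
  -- in the upper one.
  have hc2 : (⌈d⌉₊ : ℝ) ≤ 2 * d := by linarith [Nat.ceil_lt_add_one hd0.le]
  have hc0 : (0 : ℝ) < ⌈d⌉₊ := by linarith
  have h2 : (0 : ℝ) < 2 ^ (β - 1) := by positivity
  have hL0 : 0 < L := lt_of_lt_of_le (by positivity) hL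
  rw [numAtLeast_natCeil] at h
  constructor
  · calc L⁻¹ * (n * d ^ (1 - β)) ≤ (2 ^ (β - 1) / s)⁻¹ * (n * d ^ (1 - β)) := by gcongr
      _ = s * (n * (2 * d) ^ (1 - β)) := by
          rw [Real.mul_rpow (by norm_num) hd0.le, show 1 - β = -(β - 1) by ring,
            Real.rpow_neg (by norm_num : (0 : ℝ) ≤ 2)]
          field_simp
      _ ≤ s * (n * (⌈d⌉₊ : ℝ) ^ (1 - β)) := by
          have := Real.rpow_le_rpow_of_nonpos hc0 hc2 (by linarith : 1 - β ≤ 0)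
          gcongr
      _ ≤ _ := h.1
  · calc _ ≤ _ := h.2
      _ ≤ L * (n * (⌈d⌉₊ : ℝ) ^ (1 - β)) := by gcongr
      _ ≤ L * (n * d ^ (1 - β)) := by
          have := Real.rpow_le_rpow_of_nonpos hd0 hc1 (by linarith : 1 - β ≤ 0)
          gcongr

end PowerLawSAT

open PowerLawSAT in
theorem mainTheorem6 (k : ℕ) (hk : 2 ≤ k) (β : ℝ) (hβ : 2 < β) (K : ℝ) (hK : 1 ≤ K) :
    ∃ L δ : ℝ, 1 ≤ L ∧ 0 < δ ∧
      ∀ (n m : ℕ) (w : Fin n → ℝ), k ≤ n → IsPowerLaw K β w → ThetaWith K (m : ℝ) (n : ℝ) →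
        ∃ dMin dMax : ℝ, ThetaWith L dMin (wMin w) ∧ ThetaWith L dMax (wMax w) ∧
          1 - L * (n : ℝ) ^ (-δ) ≤
            (formulaLaw k m w).real
              {Φ | ∀ d ∈ Set.Icc dMin dMax,
                ThetaWith L (numAtLeast Φ d : ℝ) ((n : ℝ) * d ^ (1 - β))} := by
  have hK0 : 0 < K := by linarith
  have hk0 : 0 < k := by omega
  obtain ⟨C, s, U, A, hKC, hs, hU, hA, hbad⟩ :=
    exists_formulaLaw_real_numAtLeast_le k hk0 β hβ K hK
  obtain ⟨n₀, hn₀⟩ := eventually_mul_rpow_le_half hβ ((k : ℝ) ^ 2 * K ^ 2)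
  have hr1 : Real.exp (-(1 / 8)) < 1 := Real.exp_lt_one_iff.2 (by norm_num)
  have hr0 : 0 < Real.exp (-(1 / 8)) := Real.exp_pos _
  have hC0 : 0 < C := by linarith
  set G := (1 - Real.exp (-(1 / 8)))⁻¹ with hG
  have hG0 : 0 < G := inv_pos.2 (by linarith)
  have h2s : 0 < 2 ^ (β - 1) / s := by positivity
  -- One summand per demand: the endpoints of the range, the lower and upper bounds on the count,
  -- the summed failure probability, and small `n`.
  set L := 2 * C + 2 ^ (β - 1) / s + U + A * G + √n₀ with hL
  have hAG : 0 ≤ A * G := by positivity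
  have hsqrt : 0 ≤ √(n₀ : ℝ) := Real.sqrt_nonneg _
  have hL1 : 1 ≤ L := by linarith
  have hL0 : 0 < L := by linarith
  have hKL : K ≤ L := by linarith
  -- The factor 2 in the upper endpoint leaves room for rounding: C ⌈d⌉ ≤ 2 C d ≤ w_max. If the
  -- endpoint is below 1, the range is empty.
  refine ⟨L, 1 / 2, hL1, by norm_num, fun n m w hkn h hm => ⟨1, wMax w / (2 * C), ?_, ?_, ?_⟩⟩
  · have h1 := h.min_theta
    simp only [ThetaWith, mul_one] at h1
    constructor
    · rw [inv_mul_le_iff₀ hL0]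
      linarith [h1.2]
    · calc (1 : ℝ) = K * K⁻¹ := by field_simp
        _ ≤ L * wMin w := by gcongr; exact h1.1
  · have hmax : 0 < wMax w := (h.pos hK ⟨0, by omega⟩).trans_le (le_wMax w _)
    constructor
    · rw [inv_mul_eq_div]
      gcongr
      linarith
    · calc wMax w / (2 * C) ≤ wMax w := div_le_self hmax.le (by linarith)
        _ ≤ _ := le_mul_of_one_le_left hmax.le hL1
  have hn : 0 < n := by omega
  have hn1 : (1 : ℝ) ≤ n := by exact_mod_cast hn
  have hnpow : (n : ℝ) ^ (-(1 / 2 : ℝ)) = (√n)⁻¹ := by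
    rw [Real.rpow_neg (by positivity), ← Real.sqrt_eq_rpow]
  rw [hnpow]
  rcases lt_or_ge n n₀ with hlt | hge
  -- For n < n₀ the claimed lower bound on the probability is at most 0, because L ≥ √n₀.
  · refine le_trans ?_ measureReal_nonneg
    rw [sub_nonpos, ← div_eq_mul_inv, one_le_div (Real.sqrt_pos.2 (by linarith))]
    have : √(n : ℝ) ≤ √n₀ := Real.sqrt_le_sqrt (by exact_mod_cast hlt.le)
    linarith
  have hρ : (k : ℝ) ^ 2 * (K ^ 2 * (n : ℝ) ^ (1 / (β - 1) - 1)) ≤ 1 / 2 := by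
    rw [← mul_assoc]
    exact hn₀ n hge
  have hprob := isProbabilityMeasure_clauseLaw hk0 hn (h.pos hK) (h.div_sum_le hK hn) hρ
  -- The cap at `n` only makes the index set finite: C d ≤ w_max ≤ K n ^ (1 / (β - 1)) ≤ C n already
  -- forces d ≤ n.
  set D : Finset ℕ := {d ∈ Finset.Icc 1 n | C * (d : ℝ) ≤ wMax w} with hD
  set bad : ℕ → Set (Formula n k m) := fun d =>
    {Φ | ¬ (s * (n * (d : ℝ) ^ (1 - β)) ≤ (numAtLeast Φ d : ℝ) ∧
      (numAtLeast Φ d : ℝ) ≤ U * (n * (d : ℝ) ^ (1 - β)))} with hbad_def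
  have hsub : (⋃ d ∈ D, bad d)ᶜ ⊆ {Φ : Formula n k m | ∀ d ∈ Set.Icc 1 (wMax w / (2 * C)),
      ThetaWith L (numAtLeast Φ d : ℝ) ((n : ℝ) * d ^ (1 - β))} := by
    intro Φ hΦ d hd
    simp only [Set.mem_compl_iff, Set.mem_iUnion, not_exists] at hΦ
    refine numAtLeast_theta_of_nat (s := s) (U := U) Φ hβ hs (by linarith) (by linarith) hd.1 ?_
    have hd0 : 0 < d := by linarith [hd.1]
    have hd2 : d * (2 * C) ≤ wMax w := (le_div_iff₀ (by positivity)).1 hd.2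
    have hceil : C * (⌈d⌉₊ : ℝ) ≤ wMax w := by
      have : C * (⌈d⌉₊ : ℝ) ≤ C * (2 * d) := by
        gcongr
        linarith [Nat.ceil_lt_add_one hd0.le, hd.1]
      linarith
    have hmem : ⌈d⌉₊ ∈ D := by
      rw [hD, Finset.mem_filter, Finset.mem_Icc]
      refine ⟨⟨Nat.one_le_ceil_iff.2 hd0, ?_⟩, hceil⟩
      have hpow : (n : ℝ) ^ (1 / (β - 1)) ≤ n := by
        calc (n : ℝ) ^ (1 / (β - 1)) ≤ (n : ℝ) ^ (1 : ℝ) :=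
              Real.rpow_le_rpow_of_exponent_le hn1 (by
                rw [div_le_one (by linarith)]
                linarith)
          _ = n := Real.rpow_one _
      have : C * (⌈d⌉₊ : ℝ) ≤ C * n := by
        calc _ ≤ wMax w := hceil
          _ ≤ K * (n : ℝ) ^ (1 / (β - 1)) := h.max_theta.2
          _ ≤ _ := by gcongr
      exact_mod_cast le_of_mul_le_mul_left this hC0
    exact not_not.1 (hΦ _ hmem)
  have hsum : (formulaLaw k m w).real (⋃ d ∈ D, bad d) ≤ A * G * (√n)⁻¹ := by
    calc _ ≤ ∑ d ∈ D, (formulaLaw k m w).real (bad d) := measureReal_biUnion_finset_le _ _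
      _ ≤ ∑ d ∈ D, A * ((√n)⁻¹ * Real.exp (-(1 / 8)) ^ d) := by
          refine Finset.sum_le_sum fun d hd => ?_
          rw [hD, Finset.mem_filter, Finset.mem_Icc] at hd
          exact hbad n m w hn h hm hρ d hd.1.1 hd.2
      _ = A * (√n)⁻¹ * ∑ d ∈ D, Real.exp (-(1 / 8)) ^ d := by
          rw [Finset.mul_sum]
          exact Finset.sum_congr rfl fun d _ => by ring
      _ ≤ A * (√n)⁻¹ * G := by
          gcongr
          rw [hG, ← tsum_geometric_of_lt_one hr0.le hr1]
          exact (summable_geometric_of_lt_one hr0.le hr1).sum_le_tsum _ fun d _ => by positivity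
      _ = _ := by ring
  have hcompl := probReal_add_probReal_compl (μ := formulaLaw k m w) (s := ⋃ d ∈ D, bad d)
    (Set.toFinite _).measurableSet
  have hmono := measureReal_mono hsub (measure_ne_top (formulaLaw k m w) _)
  have hfin : A * G * (√n)⁻¹ ≤ L * (√n)⁻¹ := by
    gcongr
    linarith
  linarith
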